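/- For a Borel probability measure $\mu$ on $\mathbb{R}$ and a point $x$ of its support, let $d_\mu(x)=\liminf_{r\to 0^+}\frac{\log\mu(B(x,r))}{\log r}$ be the (lower) local dimension of $\mu$ at $x$; for $\alpha\ge 0$ let $D_\mu(\alpha)=\{x\in\operatorname{Supp}(\mu): d_\mu(x)=\alpha\}$; and let $\dim_H\mu=\inf\{\dim_H Z : Z \text{ Borel},\ \mu(Z)=1\}$. Then for all real numbers $0\le a<b\le 1$ there are a Cantor set $K\subset[0,1]$ (a non-empty, compact, perfect, totally disconnected set) and a Borel probability measure $\mu$ on $\mathbb{R}$ with $\operatorname{Supp}(\mu)=K$ such that: (i) $\mu(U)>0$ for every non-empty relatively open subset $U$ of $K$; (ii) $\dim_H\mu=b$; (iii) if $S=\{d_\mu(x): x\in K\}$, then $\min S=a$ and $\max S=b$; in particular $d_\mu(x)\in[a,b]$ for every $x\in K$; (iv) for every $\alpha\ge 0$, the set $D_\mu(\alpha)$ contains at most one point. -/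

import Mathlib

open MeasureTheory Filter Topology

open scoped ENNReal

/-- A Cantor set: a nonempty compact perfect totally disconnected set. In a metric space these are
exactly the subsets homeomorphic to `{0,1}^ℕ`. -/
structure IsCantorSet {X : Type*} [TopologicalSpace X] (K : Set X) : Prop where
  nonempty : K.Nonempty
  isCompact : IsCompact K
  perfect : Perfect K
  isTotallyDisconnected : IsTotallyDisconnected K

/-- The (lower) local dimension `d_μ(x) = liminf_{r → 0⁺} log μ(B(x,r)) / log r`, an extended real
number (it is `⊤` outside the support of `μ`). -/
noncomputable def localDim {X : Type*} [PseudoMetricSpace X] [MeasurableSpace X]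
    (μ : Measure X) (x : X) : EReal :=
  liminf (fun r : ℝ => ENNReal.log (μ (Metric.ball x r)) / ((Real.log r : ℝ) : EReal)) (𝓝[>] 0)

/-- The level set `D_μ(α)` of the points of the support of `μ` with local dimension `α`. -/
def localDimLevelSet {X : Type*} [PseudoMetricSpace X] [MeasurableSpace X]
    (μ : Measure X) (α : ℝ) : Set X :=
  {x | x ∈ μ.support ∧ localDim μ x = (α : EReal)}

/-- The Hausdorff dimension of a probability measure: the infimum of the Hausdorff dimensions of
the measurable sets of measure one. -/
noncomputable def measureDimH {X : Type*} [MetricSpace X] [MeasurableSpace X]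
    (μ : Measure X) : ℝ≥0∞ :=
  ⨅ (Z : Set X) (_ : MeasurableSet Z) (_ : μ Z = 1), dimH Z

/-! Code binary sequences by reals so that the cylinder of `ω` of length `n`, of coin-tossing mass
`2 ^ (-n)`, has diameter about `2 ^ (-n / F n ω)`. Since `F n ω` tends to `f ω`, the local dimension
of the image measure at the code of `ω` is `f ω` (`localDim_codeMap`). With `f` injective, distinct
points get distinct local dimensions; the affine image in `[a, b]` of the ternary Cantor coding is
such an `f`, with `a` and `b` attained at the constant sequences.

Two estimates carry this: a cylinder has diameter at most twice its scale (`abs_codeMap_sub_le`),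
and points that first differ at digit `n` are apart by the scale up to a factor quadratic in `n`
(`le_abs_codeMap_sub`). Polynomial factors do not affect exponents.

The measure has dimension `b` although only one sequence has `f = b`. Any set of full measure meets
almost all of a small cylinder around that sequence, where `f` is close to `b`; a uniform mass bound
there gives the lower estimate. Covering by the `2 ^ n` cylinders gives the upper one. -/

/-- A decreasing approximation `F n ω`, depending only on the first `n` coordinates of `ω`, of a
function `f` on the space of binary sequences, with values in `(0, b]`. -/
structure IsDimScheme (b : ℝ) (F : ℕ → (ℕ → Bool) → ℝ) (f : (ℕ → Bool) → ℝ) : Prop where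
  pos : ∀ n ω, 0 < F n ω
  le_top : ∀ n ω, F n ω ≤ b
  succ_le : ∀ n ω, F (n + 1) ω ≤ F n ω
  congr : ∀ n ω ω', ω' ∈ PiNat.cylinder ω n → F n ω' = F n ω
  le : ∀ n ω, f ω ≤ F n ω
  le_add : ∀ n ω, F n ω ≤ f ω + (1 / 3) ^ n

/-- The scale `2 ^ (-(n + 1) / F n ω)` of the `n`-th cylinder around `ω`. -/
noncomputable def cylScale (F : ℕ → (ℕ → Bool) → ℝ) (n : ℕ) (ω : ℕ → Bool) : ℝ :=
  (2 : ℝ) ^ (-((n + 1 : ℝ) / F n ω))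

/-- The `n`-th term of the series that defines `codeMap`. -/
noncomputable def codeTerm (F : ℕ → (ℕ → Bool) → ℝ) (ω : ℕ → Bool) (n : ℕ) : ℝ :=
  if ω n then cylScale F n ω / (n + 1) else 0

/-- The coding of binary sequences by real numbers with the given cylinder scales. -/
noncomputable def codeMap (F : ℕ → (ℕ → Bool) → ℝ) (ω : ℕ → Bool) : ℝ :=
  ∑' n, codeTerm F ω n

lemma cylScale_pos (F : ℕ → (ℕ → Bool) → ℝ) (n : ℕ) (ω : ℕ → Bool) : 0 < cylScale F n ω := by
  unfold cylScale; positivity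

lemma codeTerm_nonneg (F : ℕ → (ℕ → Bool) → ℝ) (ω : ℕ → Bool) (n : ℕ) : 0 ≤ codeTerm F ω n := by
  have := cylScale_pos F n ω
  unfold codeTerm; split_ifs <;> positivity

/-! ### Geometry of the coding map. -/

namespace IsDimScheme

variable {b : ℝ} {F : ℕ → (ℕ → Bool) → ℝ} {f : (ℕ → Bool) → ℝ}

lemma cylScale_congr (h : IsDimScheme b F f) {n : ℕ} {ω ω' : ℕ → Bool}
    (hω : ω' ∈ PiNat.cylinder ω n) : cylScale F n ω' = cylScale F n ω := by
  rw [cylScale, cylScale, h.congr n ω ω' hω]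

lemma cylScale_succ_le (h : IsDimScheme b F f) (hb : b ≤ 1) (n : ℕ) (ω : ℕ → Bool) :
    cylScale F (n + 1) ω ≤ cylScale F n ω / 2 := by
  have h1 : cylScale F n ω / 2 = (2 : ℝ) ^ (-((n + 1 : ℝ) / F n ω) - 1) := by
    rw [Real.rpow_sub_one (by norm_num), cylScale]
  rw [h1, cylScale]
  apply Real.rpow_le_rpow_of_exponent_le (by norm_num)
  have h2 : ((n : ℝ) + 1 + 1) / F n ω ≤ ((n : ℝ) + 1 + 1) / F (n + 1) ω :=
    div_le_div_of_nonneg_left (by positivity) (h.pos _ _) (h.succ_le _ _)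
  have h3 : 1 ≤ 1 / F n ω := by
    rw [le_div_iff₀ (h.pos _ _)]; linarith [h.le_top n ω]
  rw [add_div] at h2
  push_cast
  linarith

lemma cylScale_add_le (h : IsDimScheme b F f) (hb : b ≤ 1) (n j : ℕ) (ω : ℕ → Bool) :
    cylScale F (j + n) ω ≤ cylScale F n ω * (1 / 2) ^ j := by
  induction j with
  | zero => simp
  | succ j ih =>
    have := h.cylScale_succ_le hb (j + n) ω
    rw [show j + 1 + n = j + n + 1 by ring, pow_succ]
    linarith

lemma cylScale_le (h : IsDimScheme b F f) (n : ℕ) (ω : ℕ → Bool) :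
    cylScale F n ω ≤ (2 : ℝ) ^ (-((n + 1 : ℝ) / b)) := by
  apply Real.rpow_le_rpow_of_exponent_le (by norm_num)
  have : ((n : ℝ) + 1) / b ≤ ((n : ℝ) + 1) / F n ω :=
    div_le_div_of_nonneg_left (by positivity) (h.pos _ _) (h.le_top _ _)
  linarith

lemma le_cylScale (h : IsDimScheme b F f) {s : ℝ} (hs : 0 < s) {ω : ℕ → Bool} (hω : s ≤ f ω)
    (n : ℕ) : (2 : ℝ) ^ (-((n + 1 : ℝ) / s)) ≤ cylScale F n ω := by
  apply Real.rpow_le_rpow_of_exponent_le (by norm_num)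
  have : ((n : ℝ) + 1) / F n ω ≤ ((n : ℝ) + 1) / s :=
    div_le_div_of_nonneg_left (by positivity) hs (hω.trans (h.le _ _))
  linarith

lemma cylScale_le_half_pow (h : IsDimScheme b F f) (hb : b ≤ 1) (n : ℕ) (ω : ℕ → Bool) :
    cylScale F n ω ≤ (1 / 2) ^ (n + 1) := by
  have hb0 : 0 < b := (h.pos 0 ω).trans_le (h.le_top 0 ω)
  calc cylScale F n ω ≤ (2 : ℝ) ^ (-((n + 1 : ℝ) / b)) := h.cylScale_le n ω
    _ ≤ (2 : ℝ) ^ (-((n + 1 : ℕ) : ℝ)) := by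
      apply Real.rpow_le_rpow_of_exponent_le (by norm_num)
      rw [neg_le_neg_iff, le_div_iff₀ hb0]
      push_cast
      nlinarith
    _ = (1 / 2) ^ (n + 1) := by
      rw [Real.rpow_neg (by norm_num), Real.rpow_natCast]; simp

lemma codeTerm_add_le (h : IsDimScheme b F f) (hb : b ≤ 1) (ω : ℕ → Bool) (n j : ℕ) :
    codeTerm F ω (j + n) ≤ cylScale F n ω / (n + 1) * (1 / 2) ^ j := by
  have h0 := cylScale_pos F n ω
  have h1 := h.cylScale_add_le hb n j ω
  have h2 := cylScale_pos F (j + n) ω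
  unfold codeTerm
  split_ifs
  · rw [div_mul_eq_mul_div]
    apply div_le_div₀ (by positivity) h1 (by positivity)
    push_cast
    linarith [Nat.cast_nonneg (α := ℝ) j]
  · positivity

lemma summable_codeTerm (h : IsDimScheme b F f) (hb : b ≤ 1) (ω : ℕ → Bool) :
    Summable (codeTerm F ω) :=
  Summable.of_nonneg_of_le (codeTerm_nonneg F ω) (fun j => h.codeTerm_add_le hb ω 0 j)
    (summable_geometric_two.mul_left _)

lemma tsum_codeTerm_add_le (h : IsDimScheme b F f) (hb : b ≤ 1) (ω : ℕ → Bool) (n : ℕ) :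
    ∑' j, codeTerm F ω (j + n) ≤ 2 * (cylScale F n ω / (n + 1)) := by
  calc ∑' j, codeTerm F ω (j + n) ≤ ∑' j : ℕ, cylScale F n ω / (n + 1) * (1 / 2) ^ j :=
        ((summable_nat_add_iff n).2 (h.summable_codeTerm hb ω)).tsum_le_tsum
          (h.codeTerm_add_le hb ω n) (summable_geometric_two.mul_left _)
    _ = 2 * (cylScale F n ω / (n + 1)) := by rw [tsum_mul_left, tsum_geometric_two]; ring

lemma tsum_codeTerm_add_nonneg (F : ℕ → (ℕ → Bool) → ℝ) (ω : ℕ → Bool) (n : ℕ) :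
    0 ≤ ∑' j, codeTerm F ω (j + n) := tsum_nonneg fun _ => codeTerm_nonneg F ω _

lemma codeMap_eq_sum_add (h : IsDimScheme b F f) (hb : b ≤ 1) (ω : ℕ → Bool) (n : ℕ) :
    codeMap F ω = ∑ i ∈ Finset.range n, codeTerm F ω i + ∑' j, codeTerm F ω (j + n) :=
  ((h.summable_codeTerm hb ω).sum_add_tsum_nat_add n).symm

lemma sum_codeTerm_congr (h : IsDimScheme b F f) {n : ℕ} {ω ω' : ℕ → Bool}
    (hω : ω' ∈ PiNat.cylinder ω n) :
    ∑ i ∈ Finset.range n, codeTerm F ω' i = ∑ i ∈ Finset.range n, codeTerm F ω i := by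
  refine Finset.sum_congr rfl fun i hi => ?_
  have hi := Finset.mem_range.1 hi
  rw [codeTerm, codeTerm, hω i hi, h.cylScale_congr (PiNat.cylinder_anti ω hi.le hω)]

lemma codeMap_mem_Icc (h : IsDimScheme b F f) (hb : b ≤ 1) (ω : ℕ → Bool) :
    codeMap F ω ∈ Set.Icc (0 : ℝ) 1 := by
  refine ⟨tsum_nonneg (codeTerm_nonneg F ω), ?_⟩
  have h1 := h.tsum_codeTerm_add_le hb ω 0
  have h2 := h.cylScale_le_half_pow hb 0 ω
  simp only [add_zero, Nat.cast_zero, zero_add, div_one, pow_one] at h1 h2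
  rw [codeMap]
  linarith

lemma abs_codeMap_sub_le (h : IsDimScheme b F f) (hb : b ≤ 1) {n : ℕ} {ω ω' : ℕ → Bool}
    (hω : ω' ∈ PiNat.cylinder ω n) : |codeMap F ω' - codeMap F ω| ≤ 2 * cylScale F n ω := by
  have h0 := cylScale_pos F n ω
  have h1 := h.tsum_codeTerm_add_le hb ω n
  have h2 := h.tsum_codeTerm_add_le hb ω' n
  have h3 := tsum_codeTerm_add_nonneg F ω n
  have h4 := tsum_codeTerm_add_nonneg F ω' n
  have h5 : cylScale F n ω / (n + 1) ≤ cylScale F n ω :=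
    div_le_self h0.le (by linarith [Nat.cast_nonneg (α := ℝ) n])
  rw [h.cylScale_congr hω] at h2
  rw [h.codeMap_eq_sum_add hb ω n, h.codeMap_eq_sum_add hb ω' n, h.sum_codeTerm_congr hω, abs_le]
  constructor <;> linarith

/-- The scale at `n` is fixed by the digits before `n`, so both sequences share it. Digit `n`
contributes `scale / (n + 1)`, and the later digits of `ω'` recover at most `scale / (n + 2)`. The
weight `1 / (n + 1)` keeps this gap positive even when scales only halve, as can happen for `b = 1`.
-/
lemma le_codeMap_sub (h : IsDimScheme b F f) (hb : b ≤ 1) {n : ℕ} {ω ω' : ℕ → Bool}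
    (hω : ω' ∈ PiNat.cylinder ω n) (h1 : ω n = true) (h2 : ω' n = false) :
    cylScale F n ω / ((n + 1) * (n + 2)) ≤ codeMap F ω - codeMap F ω' := by
  have e := h.tsum_codeTerm_add_le hb ω' (n + 1)
  have e1 := h.cylScale_succ_le hb n ω'
  rw [h.cylScale_congr hω] at e1
  have e2 := tsum_codeTerm_add_nonneg F ω (n + 1)
  rw [h.codeMap_eq_sum_add hb ω (n + 1), h.codeMap_eq_sum_add hb ω' (n + 1),
    Finset.sum_range_succ, Finset.sum_range_succ, h.sum_codeTerm_congr hω]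
  have e3 : codeTerm F ω n = cylScale F n ω / (n + 1) := by simp [codeTerm, h1]
  have e4 : codeTerm F ω' n = 0 := by simp [codeTerm, h2]
  have e5 : 2 * (cylScale F (n + 1) ω' / ((n + 1 : ℕ) + 1)) ≤ cylScale F n ω / (n + 2) := by
    rw [← mul_div_assoc]
    push_cast
    rw [show (n : ℝ) + 1 + 1 = n + 2 by ring]
    gcongr
    linarith
  have e6 : cylScale F n ω / ((n + 1) * (n + 2)) =
      cylScale F n ω / (n + 1) - cylScale F n ω / (n + 2) := by
    field_simp; ring
  rw [e3, e4, e6]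
  linarith

lemma le_abs_codeMap_sub (h : IsDimScheme b F f) (hb : b ≤ 1) {n : ℕ} {ω ω' : ℕ → Bool}
    (hω : ω' ∈ PiNat.cylinder ω n) (hne : ω' n ≠ ω n) :
    cylScale F n ω / ((n + 1) * (n + 2)) ≤ |codeMap F ω' - codeMap F ω| := by
  rcases hn : ω n with _ | _
  · have := h.le_codeMap_sub hb ((PiNat.mem_cylinder_comm ω ω' n).1 hω)
      (by simpa [hn] using hne) hn
    rw [h.cylScale_congr hω] at this
    exact this.trans (le_abs_self _)
  · have := h.le_codeMap_sub hb hω hn (by simpa [hn] using hne)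
    rw [abs_sub_comm]
    exact this.trans (le_abs_self _)

lemma preimage_closedBall_subset_cylinder (h : IsDimScheme b F f) (hb : b ≤ 1) {n : ℕ} {r : ℝ}
    {ω : ℕ → Bool} (hr : ∀ m < n, r < cylScale F m ω / ((m + 1) * (m + 2))) :
    codeMap F ⁻¹' Metric.closedBall (codeMap F ω) r ⊆ PiNat.cylinder ω n := by
  intro ω' hω' i
  induction i using Nat.strong_induction_on with
  | _ i ih =>
    intro hi
    by_contra hne
    have h1 := h.le_abs_codeMap_sub hb (n := i) (fun j hj => ih j hj (hj.trans hi)) hne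
    rw [Set.mem_preimage, Metric.mem_closedBall, Real.dist_eq] at hω'
    linarith [hr i hi]

lemma injective_codeMap (h : IsDimScheme b F f) (hb : b ≤ 1) : Function.Injective (codeMap F) := by
  intro ω' ω hω
  funext i
  refine h.preimage_closedBall_subset_cylinder hb (n := i + 1) (r := 0) (ω := ω) (fun m _ => ?_)
    (by simp [hω]) i i.lt_succ_self
  have := cylScale_pos F m ω
  positivity

lemma tendsto_cylScale (h : IsDimScheme b F f) (hb : b ≤ 1) (ω : ℕ → Bool) :
    Tendsto (fun n => cylScale F n ω) atTop (𝓝 0) :=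
  squeeze_zero (fun n => (cylScale_pos F n ω).le) (fun n => h.cylScale_le_half_pow hb n ω)
    ((tendsto_pow_atTop_nhds_zero_of_lt_one (by norm_num) (by norm_num)).comp
      (tendsto_add_atTop_nat 1))

lemma exists_cylinder_subset (h : IsDimScheme b F f) (hb : b ≤ 1) {U : Set ℝ} {ω : ℕ → Bool}
    (hU : U ∈ 𝓝 (codeMap F ω)) : ∃ n, PiNat.cylinder ω n ⊆ codeMap F ⁻¹' U := by
  obtain ⟨r, hr, hrU⟩ := Metric.mem_nhds_iff.1 hU
  have ht := (h.tendsto_cylScale hb ω).const_mul 2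
  rw [mul_zero] at ht
  obtain ⟨n, hn⟩ := (ht.eventually_lt_const hr).exists
  refine ⟨n, fun ω' hω' => hrU ?_⟩
  rw [Metric.mem_ball, Real.dist_eq]
  exact (h.abs_codeMap_sub_le hb hω').trans_lt hn

lemma continuous_codeMap (h : IsDimScheme b F f) (hb : b ≤ 1) : Continuous (codeMap F) := by
  refine continuous_iff_continuousAt.2 fun ω U hU => ?_
  obtain ⟨n, hn⟩ := h.exists_cylinder_subset hb hU
  exact mem_map.2 (mem_of_superset
    ((PiNat.isOpen_cylinder _ ω n).mem_nhds (PiNat.self_mem_cylinder ω n)) hn)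

lemma isCantorSet_range_codeMap (h : IsDimScheme b F f) (hb : b ≤ 1) :
    IsCantorSet (Set.range (codeMap F)) where
  nonempty := Set.range_nonempty _
  isCompact := isCompact_range (h.continuous_codeMap hb)
  perfect := by
    refine ⟨(isCompact_range (h.continuous_codeMap hb)).isClosed, preperfect_iff_nhds.2 ?_⟩
    rintro _ ⟨ω, rfl⟩ U hU
    obtain ⟨n, hn⟩ := h.exists_cylinder_subset hb hU
    refine ⟨codeMap F (Function.update ω n (!ω n)), ⟨hn fun i hi => ?_, Set.mem_range_self _⟩,
      fun he => ?_⟩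
    · rw [Function.update_of_ne hi.ne]
    · simpa using congrFun (h.injective_codeMap hb he) n
  isTotallyDisconnected := by
    rw [((h.continuous_codeMap hb).isClosedEmbedding
      (h.injective_codeMap hb)).isEmbedding.isTotallyDisconnected_range]
    infer_instance

end IsDimScheme

/-! ### Coin tossing and the absorption of polynomial factors. -/

/-- The law of a sequence of independent fair coin tosses. -/
noncomputable def coinMeasure : Measure (ℕ → Bool) :=
  Measure.infinitePi fun _ => (PMF.uniformOfFintype Bool).toMeasure

instance : IsProbabilityMeasure coinMeasure := by
  unfold coinMeasure; infer_instance

lemma coinMeasure_cylinder (ω : ℕ → Bool) (n : ℕ) :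
    coinMeasure (PiNat.cylinder ω n) = ENNReal.ofReal ((1 / 2) ^ n) := by
  rw [coinMeasure, PiNat.cylinder_eq_pi, Measure.infinitePi_pi _ fun i _ => by measurability]
  simp [ENNReal.ofReal_pow, ENNReal.ofReal_inv_of_pos, ENNReal.inv_pow]

/-- The image of the coin tossing measure under the coding map. -/
noncomputable def codeMeasure (F : ℕ → (ℕ → Bool) → ℝ) : Measure ℝ :=
  coinMeasure.map (codeMap F)

/-- The geometric lower bound that turns cylinder estimates into power law estimates. -/
lemma exists_forall_half_pow_le {s s' : ℝ} (hs : 0 ≤ s) (hss : s < s') (hs1 : s' ≤ 1) :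
    ∃ N : ℕ, ∀ n ≥ N,
      (1 / 2 : ℝ) ^ n ≤ ((2 : ℝ) ^ (-((n + 1 : ℝ) / s')) / ((n + 1) * (n + 2))) ^ s := by
  have hs' : 0 < s' := hs.trans_lt hss
  set q := s / s' with hq
  have hq1 : q < 1 := (div_lt_one hs').2 hss
  set c := (2 : ℝ) ^ (1 - q) with hc
  -- The gap `s < s'` leaves a surplus growing like `c ^ n`, which beats the quadratic denominator.
  have hc1 : 1 < c := Real.one_lt_rpow (by norm_num) (by linarith)
  have ht := (tendsto_pow_const_div_const_pow_of_one_lt 2 hc1).comp (tendsto_add_atTop_nat 2)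
  obtain ⟨N, hN⟩ := eventually_atTop.1
    (ht.eventually_lt_const (show (0 : ℝ) < 1 / (2 * c ^ 2) by positivity))
  refine ⟨N, fun n hn => ?_⟩
  have h1 : 2 * ((n + 1 : ℝ) * (n + 2)) ≤ c ^ n := by
    have := hN n hn
    simp only [Function.comp_apply] at this
    rw [div_lt_div_iff₀ (by positivity) (by positivity), pow_add, one_mul] at this
    have h2 : 0 < c ^ 2 := by positivity
    push_cast at this
    have h3 : (2 * ((n : ℝ) + 2) ^ 2) * c ^ 2 < c ^ n * c ^ 2 := by linarith
    have := lt_of_mul_lt_mul_right h3 h2.le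
    nlinarith [Nat.cast_nonneg (α := ℝ) n]
  have h2 : ((n + 1 : ℝ) * (n + 2)) ^ s ≤ (n + 1) * (n + 2) := by
    conv_rhs => rw [← Real.rpow_one ((n + 1 : ℝ) * (n + 2))]
    apply Real.rpow_le_rpow_of_exponent_le _ (by linarith)
    nlinarith [Nat.cast_nonneg (α := ℝ) n]
  rw [Real.div_rpow (by positivity) (by positivity), ← Real.rpow_mul (by norm_num),
    le_div_iff₀ (by positivity)]
  have h3 : (2 : ℝ) ^ (-((n + 1 : ℝ) / s') * s) = (1 / 2) ^ n * (c ^ n * (2 : ℝ) ^ (-q)) := by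
    rw [hc, ← Real.rpow_natCast (2 ^ (1 - q)), ← Real.rpow_mul (by norm_num), ← Real.rpow_natCast,
      one_div, Real.inv_rpow (by norm_num), ← Real.rpow_neg (by norm_num),
      ← Real.rpow_add (by norm_num), ← Real.rpow_add (by norm_num)]
    congr 1
    rw [hq]
    field_simp
    ring
  rw [h3]
  have h4 : (1 / 2 : ℝ) ≤ 2 ^ (-q) := by
    rw [one_div, ← Real.rpow_neg_one]
    exact Real.rpow_le_rpow_of_exponent_le (by norm_num) (by linarith)
  have h5 : ((n + 1 : ℝ) * (n + 2)) ≤ c ^ n * (2 : ℝ) ^ (-q) := by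
    have := mul_le_mul h1 h4 (by norm_num) (by positivity)
    linarith
  gcongr
  linarith

/-! ### Support and local dimensions of the coded measure. -/

namespace IsDimScheme

variable {b : ℝ} {F : ℕ → (ℕ → Bool) → ℝ} {f : (ℕ → Bool) → ℝ}

lemma isProbabilityMeasure_codeMeasure (h : IsDimScheme b F f) (hb : b ≤ 1) :
    IsProbabilityMeasure (codeMeasure F) :=
  Measure.isProbabilityMeasure_map (h.continuous_codeMap hb).measurable.aemeasurable

lemma codeMeasure_apply (h : IsDimScheme b F f) (hb : b ≤ 1) {s : Set ℝ} (hs : MeasurableSet s) :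
    codeMeasure F s = coinMeasure (codeMap F ⁻¹' s) :=
  Measure.map_apply (h.continuous_codeMap hb).measurable hs

lemma codeMeasure_range (h : IsDimScheme b F f) (hb : b ≤ 1) :
    codeMeasure F (Set.range (codeMap F)) = 1 := by
  rw [h.codeMeasure_apply hb (isCompact_range (h.continuous_codeMap hb)).isClosed.measurableSet,
    Set.preimage_range, measure_univ]

lemma codeMeasure_inter_pos (h : IsDimScheme b F f) (hb : b ≤ 1) {U : Set ℝ} (hU : IsOpen U)
    (hne : (U ∩ Set.range (codeMap F)).Nonempty) :
    0 < codeMeasure F (U ∩ Set.range (codeMap F)) := by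
  obtain ⟨_, hx, ω, rfl⟩ := hne
  rw [h.codeMeasure_apply hb (hU.measurableSet.inter
    (isCompact_range (h.continuous_codeMap hb)).isClosed.measurableSet), Set.preimage_inter,
    Set.preimage_range, Set.inter_univ]
  obtain ⟨n, hn⟩ := h.exists_cylinder_subset hb (hU.mem_nhds hx)
  refine lt_of_lt_of_le ?_ (measure_mono hn)
  rw [coinMeasure_cylinder, ENNReal.ofReal_pos]
  positivity

lemma support_codeMeasure (h : IsDimScheme b F f) (hb : b ≤ 1) :
    (codeMeasure F).support = Set.range (codeMap F) := by
  have := h.isProbabilityMeasure_codeMeasure hb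
  have hcl := (isCompact_range (h.continuous_codeMap hb)).isClosed
  apply Set.Subset.antisymm
  · refine Measure.support_subset_of_isClosed hcl ?_
    rw [mem_ae_iff, prob_compl_eq_zero_iff hcl.measurableSet, h.codeMeasure_range hb]
  · intro x hx
    rw [Measure.mem_support_iff_forall]
    intro U hU
    obtain ⟨V, hVU, hV, hxV⟩ := mem_nhds_iff.1 hU
    exact (h.codeMeasure_inter_pos hb hV ⟨x, hxV, hx⟩).trans_le
      (measure_mono (Set.inter_subset_left.trans hVU))

/-- The measure of small balls satisfies a power law, uniformly over the points where `f` is bounded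
below by a larger exponent. -/
lemma exists_codeMeasure_closedBall_le (h : IsDimScheme b F f) (hb : b ≤ 1) {s s' : ℝ}
    (hs : 0 ≤ s) (hss : s < s') (hs1 : s' ≤ 1) :
    ∃ r₀ > 0, ∀ ω, s' ≤ f ω → ∀ r, 0 < r → r < r₀ →
      codeMeasure F (Metric.closedBall (codeMap F ω) r) ≤ ENNReal.ofReal (r ^ s) := by
  have hs' : 0 < s' := hs.trans_lt hss
  obtain ⟨N, hN⟩ := exists_forall_half_pow_le hs hss hs1
  -- `g` bounds the true separations `G` from below using only `f ω ≥ s'`, so the threshold `g N`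
  -- does not depend on `ω`.
  set g : ℕ → ℝ := fun n => (2 : ℝ) ^ (-((n + 1 : ℝ) / s')) / ((n + 1) * (n + 2)) with hg
  have hganti : Antitone g := by
    intro m n hmn
    have : (m : ℝ) ≤ n := by exact_mod_cast hmn
    simp only [hg]
    apply div_le_div₀ (by positivity) _ (by positivity) (by gcongr)
    apply Real.rpow_le_rpow_of_exponent_le (by norm_num)
    rw [neg_le_neg_iff]
    gcongr
  refine ⟨g N, by simp only [hg]; positivity, fun ω hω r hr hrN => ?_⟩
  set G : ℕ → ℝ := fun n => cylScale F n ω / ((n + 1) * (n + 2)) with hG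
  have hgG : ∀ n, g n ≤ G n := fun n => by
    simp only [hg, hG]
    gcongr
    exact h.le_cylScale hs' hω n
  have hex : ∃ n, G n ≤ r := by
    obtain ⟨n, hn⟩ := ((h.tendsto_cylScale hb ω).eventually_lt_const hr).exists
    refine ⟨n, le_trans (div_le_self (cylScale_pos F n ω).le ?_) hn.le⟩
    nlinarith [Nat.cast_nonneg (α := ℝ) n]
  classical
  -- At the first level whose separation is at most `r`, the earlier separations exceed `r` and
  -- confine the ball to one cylinder.
  have hn := Nat.find_spec hex
  have hmin : ∀ m < Nat.find hex, r < G m := fun m hm => not_le.1 (Nat.find_min hex hm)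
  set n := Nat.find hex
  have hNn : N ≤ n := by
    by_contra hlt
    have := hganti (not_le.1 hlt).le
    linarith [hgG n]
  calc codeMeasure F (Metric.closedBall (codeMap F ω) r)
      = coinMeasure (codeMap F ⁻¹' Metric.closedBall (codeMap F ω) r) :=
        h.codeMeasure_apply hb Metric.isClosed_closedBall.measurableSet
    _ ≤ coinMeasure (PiNat.cylinder ω n) :=
        measure_mono (h.preimage_closedBall_subset_cylinder hb hmin)
    _ = ENNReal.ofReal ((1 / 2) ^ n) := coinMeasure_cylinder ω n
    _ ≤ ENNReal.ofReal (r ^ s) := by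
        apply ENNReal.ofReal_le_ofReal
        refine (hN n hNn).trans ?_
        have : 0 ≤ g n := by simp only [hg]; positivity
        exact Real.rpow_le_rpow this ((hgG n).trans hn) hs

lemma log_div_log_eq (h : IsDimScheme b F f) (hb : b ≤ 1) (ω : ℕ → Bool) {r : ℝ} (hr : 0 < r) :
    0 < (codeMeasure F).real (Metric.ball (codeMap F ω) r) ∧
    ENNReal.log (codeMeasure F (Metric.ball (codeMap F ω) r)) / ((Real.log r : ℝ) : EReal) =
      ((Real.log ((codeMeasure F).real (Metric.ball (codeMap F ω) r)) / Real.log r : ℝ) :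
        EReal) := by
  have := h.isProbabilityMeasure_codeMeasure hb
  have h0 : codeMeasure F (Metric.ball (codeMap F ω) r) ≠ 0 := by
    refine ne_of_gt ((h.codeMeasure_inter_pos hb Metric.isOpen_ball
      ⟨codeMap F ω, Metric.mem_ball_self hr, Set.mem_range_self ω⟩).trans_le
      (measure_mono Set.inter_subset_left))
  refine ⟨ENNReal.toReal_pos h0 (measure_ne_top _ _), ?_⟩
  rw [ENNReal.log_pos_real h0 (measure_ne_top _ _), ← EReal.coe_div, measureReal_def]

lemma le_localDim_codeMap (h : IsDimScheme b F f) (hb : b ≤ 1) (ω : ℕ → Bool) :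
    (f ω : EReal) ≤ localDim (codeMeasure F) (codeMap F ω) := by
  have := h.isProbabilityMeasure_codeMeasure hb
  rw [← EReal.ge_of_forall_gt_iff_ge]
  intro z hz
  have hz : z < f ω := EReal.coe_lt_coe_iff.1 hz
  refine le_liminf_of_le (by isBoundedDefault) ?_
  have hsmall : ∀ᶠ r : ℝ in 𝓝[>] 0, r ∈ Set.Ioo (0 : ℝ) 1 := Ioo_mem_nhdsGT one_pos
  -- Negative `z` needs only that the quotient is nonnegative; this also covers `f ω = 0`, where no
  -- positive exponent is available.
  rcases lt_or_ge z 0 with hz0 | hz0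
  · filter_upwards [hsmall] with r hr
    obtain ⟨h1, h2⟩ := h.log_div_log_eq hb ω hr.1
    rw [h2, EReal.coe_le_coe_iff]
    exact hz0.le.trans (div_nonneg_of_nonpos (Real.log_nonpos h1.le measureReal_le_one)
      (Real.log_nonpos hr.1.le hr.2.le))
  · obtain ⟨r₀, hr₀, H⟩ := h.exists_codeMeasure_closedBall_le hb hz0 hz
      ((h.le 0 ω).trans ((h.le_top 0 ω).trans hb))
    filter_upwards [hsmall, Ioo_mem_nhdsGT hr₀] with r hr hr'
    obtain ⟨h1, h2⟩ := h.log_div_log_eq hb ω hr.1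
    rw [h2, EReal.coe_le_coe_iff, le_div_iff_of_neg (Real.log_neg hr.1 hr.2),
      ← Real.log_rpow hr.1]
    apply Real.log_le_log h1
    exact ENNReal.toReal_le_of_le_ofReal (by have := hr.1; positivity)
      ((measure_mono Metric.ball_subset_closedBall).trans (H ω le_rfl r hr.1 hr'.2))

lemma tendsto_apply (h : IsDimScheme b F f) (ω : ℕ → Bool) :
    Tendsto (fun n => F n ω) atTop (𝓝 (f ω)) := by
  have ht : Tendsto (fun n : ℕ => f ω + (1 / 3 : ℝ) ^ n) atTop (𝓝 (f ω + 0)) :=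
    (tendsto_pow_atTop_nhds_zero_of_lt_one (by norm_num) (by norm_num)).const_add _
  rw [add_zero] at ht
  exact tendsto_of_tendsto_of_tendsto_of_le_of_le tendsto_const_nhds ht (fun n => h.le n ω)
    (fun n => h.le_add n ω)

lemma localDim_codeMap_le (h : IsDimScheme b F f) (hb : b ≤ 1) (hf : ∀ ω, 0 ≤ f ω)
    (ω : ℕ → Bool) : localDim (codeMeasure F) (codeMap F ω) ≤ f ω := by
  have := h.isProbabilityMeasure_codeMeasure hb
  rw [← EReal.le_of_forall_lt_iff_le]
  intro t ht
  have ht : f ω < t := EReal.coe_lt_coe_iff.1 ht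
  obtain ⟨u, hu, hut⟩ := exists_between ht
  have hu0 : 0 < u := (hf ω).trans_lt hu
  have ht0 : 0 < t := hu0.trans hut
  refine liminf_le_of_frequently_le ?_ (by isBoundedDefault)
  -- A liminf is bounded by its values along one sequence of radii. The radius 4 times the scale
  -- puts the cylinder inside the open ball; its `log 4` is the 2 absorbed in `hlarge`.
  have hlim : Tendsto (fun n => 4 * cylScale F n ω) atTop (𝓝[>] 0) := by
    refine tendsto_nhdsWithin_iff.2 ⟨?_, Eventually.of_forall fun n => ?_⟩
    · simpa using (h.tendsto_cylScale hb ω).const_mul 4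
    · have := cylScale_pos F n ω
      simp only [Set.mem_Ioi]; positivity
  refine hlim.frequently (Eventually.frequently ?_)
  have hd : 0 < 1 / u - 1 / t := sub_pos.2 (one_div_lt_one_div_of_lt hu0 hut)
  have hlarge : ∀ᶠ n : ℕ in atTop, 2 ≤ (n : ℝ) * (1 / u - 1 / t) :=
    (tendsto_natCast_atTop_atTop.atTop_mul_const hd).eventually_ge_atTop 2
  filter_upwards [(h.tendsto_apply ω).eventually_lt_const hu, hlarge,
    hlim (Ioo_mem_nhdsGT one_pos)] with n hn1 hn2 hn3
  obtain ⟨h1, h2⟩ := h.log_div_log_eq hb ω hn3.1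
  rw [h2, EReal.coe_le_coe_iff, div_le_iff_of_neg (Real.log_neg hn3.1 hn3.2)]
  have hl2 : 0 < Real.log 2 := Real.log_pos (by norm_num)
  have hm : (1 / 2 : ℝ) ^ n ≤
      (codeMeasure F).real (Metric.ball (codeMap F ω) (4 * cylScale F n ω)) := by
    rw [measureReal_def, ← ENNReal.ofReal_le_iff_le_toReal (measure_ne_top _ _),
      ← coinMeasure_cylinder ω n, h.codeMeasure_apply hb Metric.isOpen_ball.measurableSet]
    apply measure_mono
    intro ω' hω'
    rw [Set.mem_preimage, Metric.mem_ball, Real.dist_eq]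
    have := h.abs_codeMap_sub_le hb hω'
    linarith [cylScale_pos F n ω]
  have hlogm := Real.log_le_log (by positivity) hm
  rw [Real.log_pow, one_div, Real.log_inv] at hlogm
  have hlogr : Real.log (4 * cylScale F n ω) = (2 - (n + 1 : ℝ) / F n ω) * Real.log 2 := by
    rw [Real.log_mul (by norm_num) (cylScale_pos F n ω).ne', cylScale,
      Real.log_rpow (by norm_num), show (4 : ℝ) = 2 ^ 2 by norm_num, Real.log_pow]
    push_cast; ring
  rw [hlogr]
  refine le_trans ?_ hlogm
  have h3 : (n : ℝ) / u ≤ (n + 1 : ℝ) / F n ω :=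
    div_le_div₀ (by positivity) (by linarith) (h.pos n ω) hn1.le
  have h4 : 2 - (n + 1 : ℝ) / F n ω ≤ -(n / t) := by
    have : (n : ℝ) * (1 / u - 1 / t) = n / u - n / t := by ring
    linarith
  calc t * ((2 - (n + 1 : ℝ) / F n ω) * Real.log 2) ≤ t * (-(n / t) * Real.log 2) := by gcongr
    _ = n * -Real.log 2 := by field_simp

lemma localDim_codeMap (h : IsDimScheme b F f) (hb : b ≤ 1) (hf : ∀ ω, 0 ≤ f ω)
    (ω : ℕ → Bool) : localDim (codeMeasure F) (codeMap F ω) = f ω :=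
  le_antisymm (h.localDim_codeMap_le hb hf ω) (h.le_localDim_codeMap hb ω)

/-! ### Hausdorff dimension of the coded measure. -/

lemma dimH_range_codeMap_le (h : IsDimScheme b F f) (hb : b ≤ 1) :
    dimH (Set.range (codeMap F)) ≤ ENNReal.ofReal b := by
  have hb0 : 0 < b := (h.pos 0 fun _ => true).trans_le (h.le_top 0 _)
  refine dimH_le_of_hausdorffMeasure_ne_top (d := b.toNNReal) (ne_top_of_le_ne_top
    (b := 2) (by simp) ?_)
  rw [Real.coe_toNNReal b hb0.le]
  set r : ℕ → ℝ := fun n => 2 * (2 : ℝ) ^ (-((n + 1 : ℝ) / b)) with hr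
  set t : (n : ℕ) → (Fin n → Bool) → Set ℝ :=
    fun n v => codeMap F '' {ω | ∀ i : Fin n, ω i = v i} with ht
  have hdiam : ∀ n v, Metric.ediam (t n v) ≤ ENNReal.ofReal (r n) := by
    intro n v
    refine Metric.ediam_le ?_
    rintro _ ⟨ω, hω, rfl⟩ _ ⟨ω', hω', rfl⟩
    rw [edist_dist]
    apply ENNReal.ofReal_le_ofReal
    rw [Real.dist_eq]
    refine (h.abs_codeMap_sub_le hb (n := n) fun i hi => ?_).trans
      (mul_le_mul_of_nonneg_left (h.cylScale_le n ω') (by norm_num))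
    exact (hω ⟨i, hi⟩).trans (hω' ⟨i, hi⟩).symm
  have hrt : Tendsto (fun n => ENNReal.ofReal (r n)) atTop (𝓝 0) := by
    rw [← ENNReal.ofReal_zero]
    refine ENNReal.tendsto_ofReal ?_
    have hle : ∀ n, r n ≤ (1 / 2) ^ n := fun n => by
      have e : (2 : ℝ) ^ (-((n + 1 : ℝ) / b)) ≤ (2 : ℝ) ^ (-((n + 1 : ℕ) : ℝ)) := by
        apply Real.rpow_le_rpow_of_exponent_le (by norm_num)
        rw [neg_le_neg_iff, le_div_iff₀ hb0]
        push_cast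
        nlinarith
      rw [Real.rpow_neg (y := ((n + 1 : ℕ) : ℝ)) (by norm_num), Real.rpow_natCast, ← inv_pow,
        pow_succ] at e
      simp only [hr, one_div]
      linarith
    exact squeeze_zero (fun n => by simp only [hr]; positivity) hle
      (tendsto_pow_atTop_nhds_zero_of_lt_one (by norm_num) (by norm_num))
  refine (Measure.hausdorffMeasure_le_liminf_sum b _ _ hrt t
    (Eventually.of_forall hdiam) (Eventually.of_forall fun n => ?_)).trans ?_
  · rintro _ ⟨ω, rfl⟩
    exact Set.mem_iUnion.2 ⟨fun i => ω i, ω, fun _ => rfl, rfl⟩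
  · refine liminf_le_of_frequently_le (Frequently.of_forall fun n => ?_)
    calc ∑ v, Metric.ediam (t n v) ^ b
        ≤ ∑ _v : Fin n → Bool, ENNReal.ofReal (2 * (1 / 2) ^ n) := by
          refine Finset.sum_le_sum fun v _ => ?_
          refine (ENNReal.rpow_le_rpow (hdiam n v) hb0.le).trans ?_
          rw [ENNReal.ofReal_rpow_of_nonneg (by simp only [hr]; positivity) hb0.le]
          apply ENNReal.ofReal_le_ofReal
          simp only [hr]
          rw [Real.mul_rpow (by norm_num) (by positivity), ← Real.rpow_mul (by norm_num)]
          have e1 : (2 : ℝ) ^ b ≤ 2 := by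
            conv_rhs => rw [← Real.rpow_one 2]
            exact Real.rpow_le_rpow_of_exponent_le (by norm_num) hb
          have e2 : (2 : ℝ) ^ (-((n + 1 : ℝ) / b) * b) ≤ (1 / 2) ^ n := by
            rw [neg_mul, div_mul_cancel₀ _ hb0.ne', one_div, inv_pow, ← Real.rpow_natCast,
              ← Real.rpow_neg (by norm_num)]
            exact Real.rpow_le_rpow_of_exponent_le (by norm_num) (by linarith)
          gcongr
      _ = 2 := by
          rw [Finset.sum_const, Finset.card_univ, Fintype.card_fun, Fintype.card_bool,
            Fintype.card_fin, nsmul_eq_mul, ← ENNReal.ofReal_natCast,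
            ← ENNReal.ofReal_mul (by positivity)]
          have : ((2 ^ n : ℕ) : ℝ) * (2 * (1 / 2) ^ n) = 2 := by
            push_cast
            rw [mul_left_comm, ← mul_pow]
            norm_num
          rw [this]
          norm_num

/-- The mass distribution principle for `codeMeasure` on a cylinder. -/
lemma le_dimH_of_codeMeasure_eq_one (h : IsDimScheme b F f) (hb : b ≤ 1) {ω : ℕ → Bool}
    (hω : f ω = b) {Z : Set ℝ} (hZ1 : codeMeasure F Z = 1) :
    ENNReal.ofReal b ≤ dimH Z := by
  have := h.isProbabilityMeasure_codeMeasure hb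
  refine ENNReal.le_of_forall_nnreal_lt fun d hd => le_dimH_of_hausdorffMeasure_ne_zero ?_
  have hdb : (d : ℝ) < b := by
    rw [← ENNReal.ofReal_coe_nnreal] at hd
    exact lt_of_not_ge fun hge => absurd (ENNReal.ofReal_le_ofReal hge) (not_le.2 hd)
  obtain ⟨s', hs1, hs2⟩ := exists_between hdb
  obtain ⟨r₀, hr₀, H⟩ := h.exists_codeMeasure_closedBall_le hb d.2 hs1 (hs2.le.trans hb)
  -- On this cylinder `F n` is constant and at least `f ω = b`, so `f` stays above `b - (1 / 3) ^ n
  -- > s'`.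
  obtain ⟨n, hn⟩ := exists_pow_lt_of_lt_one (sub_pos.2 hs2) (show (1 / 3 : ℝ) < 1 by norm_num)
  set A := codeMap F '' PiNat.cylinder ω n with hA
  have hAm : MeasurableSet A := by
    have : IsClosed (PiNat.cylinder ω n) := by
      rw [PiNat.cylinder_eq_pi]
      exact isClosed_set_pi fun _ _ => isClosed_singleton
    exact (this.isCompact.image (h.continuous_codeMap hb)).isClosed.measurableSet
  have hfA : ∀ ω' ∈ PiNat.cylinder ω n, s' ≤ f ω' := fun ω' hω' => by
    have e1 := h.le_add n ω'
    rw [h.congr n ω ω' hω'] at e1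
    linarith [h.le n ω]
  have hle : (codeMeasure F).restrict A ≤ Measure.hausdorffMeasure (d : ℝ) := by
    refine Measure.le_hausdorffMeasure _ _ (ENNReal.ofReal (r₀ / 2))
      (ENNReal.ofReal_pos.2 (by positivity)) fun s hs => ?_
    rw [Measure.restrict_apply' hAm]
    rcases Set.eq_empty_or_nonempty (s ∩ A) with he | ⟨_, hxs, ω', hω', rfl⟩
    · simp [he]
    have hfin : Metric.ediam s ≠ ⊤ := ne_top_of_le_ne_top ENNReal.ofReal_ne_top hs
    have hdlt : Metric.diam s < r₀ := by
      have : Metric.diam s ≤ r₀ / 2 := ENNReal.toReal_le_of_le_ofReal (by positivity) hs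
      linarith
    -- The ball bound needs a positive radius while `s` may have diameter zero, so `r` decreases to
    -- the diameter.
    have hcont : Tendsto (fun r : ℝ => ENNReal.ofReal r ^ (d : ℝ)) (𝓝[>] (Metric.diam s))
        (𝓝 (ENNReal.ofReal (Metric.diam s) ^ (d : ℝ))) :=
      ((ENNReal.continuous_rpow_const.comp ENNReal.continuous_ofReal).tendsto _).mono_left
        nhdsWithin_le_nhds
    have hdiam : ENNReal.ofReal (Metric.diam s) = Metric.ediam s := ENNReal.ofReal_toReal hfin
    rw [hdiam] at hcont
    refine ge_of_tendsto hcont ?_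
    filter_upwards [Ioo_mem_nhdsGT hdlt] with r hr
    have hr0 : 0 < r := Metric.diam_nonneg.trans_lt hr.1
    rw [ENNReal.ofReal_rpow_of_nonneg hr0.le d.coe_nonneg]
    refine (measure_mono ?_).trans (H ω' (hfA ω' hω') r hr0 hr.2)
    rintro y ⟨hy, -⟩
    exact (Metric.dist_le_diam_of_mem' hfin hy hxs).trans hr.1.le
  have hApos : codeMeasure F A ≠ 0 := by
    rw [h.codeMeasure_apply hb hAm]
    refine ne_of_gt (lt_of_lt_of_le ?_ (measure_mono (Set.subset_preimage_image _ _)))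
    rw [coinMeasure_cylinder, ENNReal.ofReal_pos]
    positivity
  have hZA : (codeMeasure F).restrict A Z ≠ 0 := by
    intro h0
    rw [Measure.restrict_apply' hAm] at h0
    have h1 : codeMeasure F Z + codeMeasure F A ≤ 1 := by
      have := measure_union_add_inter (μ := codeMeasure F) Z hAm
      rw [h0, add_zero] at this
      rw [← this]
      exact prob_le_one
    rw [hZ1] at h1
    exact hApos (le_antisymm ((ENNReal.add_le_add_iff_left ENNReal.one_ne_top).1
      (h1.trans_eq (add_zero 1).symm)) bot_le)
  exact fun h0 => hZA (le_antisymm ((hle Z).trans h0.le) bot_le)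

lemma measureDimH_codeMeasure (h : IsDimScheme b F f) (hb : b ≤ 1) {ω : ℕ → Bool}
    (hω : f ω = b) : measureDimH (codeMeasure F) = ENNReal.ofReal b := by
  apply le_antisymm
  · exact iInf_le_of_le (Set.range (codeMap F)) <| iInf_le_of_le
      (isCompact_range (h.continuous_codeMap hb)).isClosed.measurableSet <|
      iInf_le_of_le (h.codeMeasure_range hb) (h.dimH_range_codeMap_le hb)
  · exact le_iInf fun Z => le_iInf fun _ => le_iInf fun hZ =>
      h.le_dimH_of_codeMeasure_eq_one hb hω hZ

end IsDimScheme

/-! ### The ternary coding as target function. -/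

/-- The ternary coding of binary sequences, with values in the middle third Cantor set. -/
noncomputable def ternaryCode (ω : ℕ → Bool) : ℝ := 2 / 3 * Cardinal.cantorFunction (1 / 3) ω

lemma ternaryCode_injective : Function.Injective ternaryCode := fun _ _ h =>
  Cardinal.cantorFunction_injective (by norm_num) (by norm_num)
    (mul_left_cancel₀ (by norm_num) h)

/-- The right end point of the interval of the `n`-th step of the construction of the middle third
Cantor set that contains `ternaryCode ω`. -/
noncomputable def ternaryUpper (n : ℕ) (ω : ℕ → Bool) : ℝ :=
  2 / 3 * ∑ i ∈ Finset.range n, Cardinal.cantorFunctionAux (1 / 3) ω i + (1 / 3) ^ n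

lemma ternaryUpper_succ_le (n : ℕ) (ω : ℕ → Bool) :
    ternaryUpper (n + 1) ω ≤ ternaryUpper n ω := by
  have : Cardinal.cantorFunctionAux (1 / 3) ω n ≤ (1 / 3) ^ n := by
    rcases hn : ω n with _ | _ <;> simp [Cardinal.cantorFunctionAux, hn]
  rw [ternaryUpper, ternaryUpper, Finset.sum_range_succ, pow_succ]
  linarith

lemma antitone_ternaryUpper (ω : ℕ → Bool) : Antitone fun n => ternaryUpper n ω :=
  antitone_nat_of_succ_le fun n => ternaryUpper_succ_le n ω

lemma tendsto_ternaryUpper (ω : ℕ → Bool) :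
    Tendsto (fun n => ternaryUpper n ω) atTop (𝓝 (ternaryCode ω)) := by
  have h1 := (Cardinal.summable_cantor_function (c := 1 / 3) ω (by norm_num)
    (by norm_num)).hasSum.tendsto_sum_nat.const_mul (2 / 3 : ℝ)
  have h2 := tendsto_pow_atTop_nhds_zero_of_lt_one (r := (1 / 3 : ℝ)) (by norm_num) (by norm_num)
  simpa [ternaryUpper, ternaryCode, Cardinal.cantorFunction] using h1.add h2

lemma ternaryCode_le_ternaryUpper (n : ℕ) (ω : ℕ → Bool) : ternaryCode ω ≤ ternaryUpper n ω :=
  (antitone_ternaryUpper ω).le_of_tendsto (tendsto_ternaryUpper ω) n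

lemma ternaryUpper_le_one (n : ℕ) (ω : ℕ → Bool) : ternaryUpper n ω ≤ 1 := by
  have := antitone_ternaryUpper ω (Nat.zero_le n)
  simpa [ternaryUpper] using this

lemma cantorFunctionAux_third_nonneg (ω : ℕ → Bool) (n : ℕ) :
    0 ≤ Cardinal.cantorFunctionAux (1 / 3) ω n :=
  Cardinal.cantorFunctionAux_nonneg (by norm_num)

lemma ternaryUpper_pos (n : ℕ) (ω : ℕ → Bool) : 0 < ternaryUpper n ω := by
  have := Finset.sum_nonneg fun i (_ : i ∈ Finset.range n) => cantorFunctionAux_third_nonneg ω i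
  unfold ternaryUpper
  positivity

lemma ternaryUpper_le_add (n : ℕ) (ω : ℕ → Bool) :
    ternaryUpper n ω ≤ ternaryCode ω + (1 / 3) ^ n := by
  have := (Cardinal.summable_cantor_function (c := 1 / 3) ω (by norm_num)
    (by norm_num)).sum_le_tsum (Finset.range n) fun i _ => cantorFunctionAux_third_nonneg ω i
  rw [ternaryUpper, ternaryCode, Cardinal.cantorFunction]
  linarith

lemma ternaryCode_nonneg (ω : ℕ → Bool) : 0 ≤ ternaryCode ω :=
  mul_nonneg (by norm_num) (tsum_nonneg (cantorFunctionAux_third_nonneg ω))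

lemma ternaryCode_le_one (ω : ℕ → Bool) : ternaryCode ω ≤ 1 :=
  (ternaryCode_le_ternaryUpper 0 ω).trans (ternaryUpper_le_one 0 ω)

lemma ternaryCode_false : ternaryCode (fun _ => false) = 0 := by
  simp [ternaryCode, Cardinal.cantorFunction, Cardinal.cantorFunctionAux]

lemma ternaryCode_true : ternaryCode (fun _ => true) = 1 := by
  simp only [ternaryCode, Cardinal.cantorFunction, Cardinal.cantorFunctionAux, cond_true]
  rw [tsum_geometric_of_lt_one (by norm_num) (by norm_num)]
  norm_num

/-- Right end points of the construction intervals, rather than left ones, give a decreasing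
approximation that stays positive even when `a = 0`. The error bound uses `b - a ≤ 1`. -/
lemma isDimScheme_ternary {a b : ℝ} (ha : 0 ≤ a) (hab : a < b) (hb : b ≤ 1) :
    IsDimScheme b (fun n ω => a + (b - a) * ternaryUpper n ω)
      (fun ω => a + (b - a) * ternaryCode ω) where
  pos n ω := by
    have := mul_pos (sub_pos.2 hab) (ternaryUpper_pos n ω)
    linarith
  le_top n ω := by nlinarith [ternaryUpper_le_one n ω]
  succ_le n ω := by nlinarith [ternaryUpper_succ_le n ω]
  congr n ω ω' hω := by
    have : ternaryUpper n ω' = ternaryUpper n ω := by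
      rw [ternaryUpper, ternaryUpper]
      congr 2
      refine Finset.sum_congr rfl fun i hi => ?_
      rw [Cardinal.cantorFunctionAux, Cardinal.cantorFunctionAux, hω i (Finset.mem_range.1 hi)]
    rw [this]
  le n ω := by nlinarith [ternaryCode_le_ternaryUpper n ω]
  le_add n ω := by
    have h1 := ternaryUpper_le_add n ω
    have h2 : (0 : ℝ) < (1 / 3) ^ n := by positivity
    nlinarith

theorem theorem1 (a b : ℝ) (ha : 0 ≤ a) (hab : a < b) (hb : b ≤ 1) :
    ∃ (μ : Measure ℝ) (K : Set ℝ),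
      IsProbabilityMeasure μ ∧
      IsCantorSet K ∧
      K ⊆ Set.Icc 0 1 ∧
      μ.support = K ∧
      (∀ U : Set ℝ, IsOpen U → (U ∩ K).Nonempty → 0 < μ (U ∩ K)) ∧
      measureDimH μ = ENNReal.ofReal b ∧
      (∀ x ∈ K, localDim μ x ∈ Set.Icc (a : EReal) (b : EReal)) ∧
      IsLeast (localDim μ '' K) (a : EReal) ∧
      IsGreatest (localDim μ '' K) (b : EReal) ∧
      (∀ α : ℝ, 0 ≤ α → (localDimLevelSet μ α).Subsingleton) := by
  have h := isDimScheme_ternary ha hab hb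
  set F : ℕ → (ℕ → Bool) → ℝ := fun n ω => a + (b - a) * ternaryUpper n ω
  set f : (ℕ → Bool) → ℝ := fun ω => a + (b - a) * ternaryCode ω with hf
  have hfa : ∀ ω, a ≤ f ω := fun ω => by
    have := mul_nonneg (sub_pos.2 hab).le (ternaryCode_nonneg ω)
    simp only [hf]; linarith
  have hfb : ∀ ω, f ω ≤ b := fun ω => (h.le 0 ω).trans (h.le_top 0 ω)
  have hdim := h.localDim_codeMap hb fun ω => ha.trans (hfa ω)
  have hfalse : f (fun _ => false) = a := by simp [hf, ternaryCode_false]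
  have htrue : f (fun _ => true) = b := by simp [hf, ternaryCode_true]
  have hmem : ∀ x ∈ Set.range (codeMap F),
      localDim (codeMeasure F) x ∈ Set.Icc (a : EReal) (b : EReal) := by
    rintro _ ⟨ω, rfl⟩
    rw [hdim ω]
    exact ⟨EReal.coe_le_coe_iff.2 (hfa ω), EReal.coe_le_coe_iff.2 (hfb ω)⟩
  refine ⟨codeMeasure F, Set.range (codeMap F), h.isProbabilityMeasure_codeMeasure hb,
    h.isCantorSet_range_codeMap hb, ?_, h.support_codeMeasure hb,
    fun U hU hne => h.codeMeasure_inter_pos hb hU hne, h.measureDimH_codeMeasure hb htrue, hmem,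
    ⟨⟨_, ⟨fun _ => false, rfl⟩, by rw [hdim, hfalse]⟩, ?_⟩,
    ⟨⟨_, ⟨fun _ => true, rfl⟩, by rw [hdim, htrue]⟩, ?_⟩, ?_⟩
  · rintro _ ⟨ω, rfl⟩
    exact h.codeMap_mem_Icc hb ω
  · rintro _ ⟨x, hx, rfl⟩
    exact (hmem x hx).1
  · rintro _ ⟨x, hx, rfl⟩
    exact (hmem x hx).2
  · rintro α - x ⟨hx, hxα⟩ y ⟨hy, hyα⟩
    rw [h.support_codeMeasure hb] at hx hy
    obtain ⟨ω, rfl⟩ := hx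
    obtain ⟨ω', rfl⟩ := hy
    -- Equal local dimensions mean equal values of `f`, and `f` is injective because `a < b`.
    have e : f ω = f ω' := EReal.coe_injective (by rw [← hdim, ← hdim, hxα, hyα])
    have e' : ternaryCode ω = ternaryCode ω' :=
      mul_left_cancel₀ (sub_pos.2 hab).ne' (add_left_cancel e)
    rw [ternaryCode_injective e']
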